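/- For a nonempty compact metric space $(X,\rho)$, $s\ge 0$ and $\varepsilon>0$, let $$\mathrm H^s_\varepsilon(X,\rho)=\inf\Big\{\sum_{k=1}^\infty(\operatorname{diam}_\rho E_k)^s:\ X=\bigcup_{k=1}^\infty E_k,\ \operatorname{diam}_\rho E_k<\varepsilon\text{ for all }k\Big\}$$ (with $0^0=1$ and $(\operatorname{diam}\emptyset)^s=0$), and let $\dim_{\mathrm H}(X,\rho,\varepsilon)=\sup\{s\ge 0:\mathrm H^s_\varepsilon(X,\rho)\ge 1\}$. For a continuous map $h:X\to X$ and $n\ge1$ put $\rho_n(x,y)=\max_{0\le i<n}\rho(h^i(x),h^i(y))$. The lower mean Hausdorff dimension of $(X,\rho,h)$ is $$\underline{\mathrm{mdim}}_{\mathrm H}(X,\rho,h)=\lim_{\varepsilon\to0}\ \liminf_{n\to\infty}\ \frac1n\dim_{\mathrm H}(X,\rho_n,\varepsilon)\in[0,\infty];$$ the limit exists because the inner quantity does not decrease as $\varepsilon$ decreases. **Proposition.** Let $(\mathbb M,d)$ and $(\mathbb E,d')$ be nonempty compact metric spaces, let $f:\mathbb M\to\mathbb M$ and $g:\mathbb E\to\mathbb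 E$ be continuous maps, and equip $\mathbb M\times\mathbb E$ with the metric $$(d\times d')\big((x_1,y_1),(x_2,y_2)\big)=\max\{d(x_1,x_2),\,d'(y_1,y_2)\}.$$ Then $$\underline{\mathrm{mdim}}_{\mathrm H}(\mathbb M\times\mathbb E,\,d\times d',\,f\times g)\ \ge\ \underline{\mathrm{mdim}}_{\mathrm H}(\mathbb M,d,f)+\underline{\mathrm{mdim}}_{\mathrm H}(\mathbb E,d',g).$$ -/

import Mathlib

namespace MeanHausdorff

open Filter Topology
open scoped ENNReal NNReal

noncomputable section

variable {X : Type*}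

/-- The diameter of a set `E` with respect to a metric `d`. -/
def diam (d : X → X → ℝ) (E : Set X) : ℝ≥0∞ :=
  ⨆ x ∈ E, ⨆ y ∈ E, ENNReal.ofReal (d x y)

open Classical in
/-- The power `(diam E) ^ s`, with the conventions `0 ^ 0 = 1` and `(diam ∅) ^ s = 0`. -/
def diamPow (d : X → X → ℝ) (s : ℝ≥0) (E : Set X) : ℝ≥0∞ :=
  if E = ∅ then 0 else diam d E ^ (s : ℝ)

/-- `H_ε^s(X, d)`: the infimum of `∑ (diam E_n) ^ s` over the countable covers of `X` by sets
`E_n` of diameter less than `ε`. -/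
def hausdorffPre (d : X → X → ℝ) (ε : ℝ) (s : ℝ≥0) : ℝ≥0∞ :=
  ⨅ (E : ℕ → Set X) (_ : ⋃ n, E n = Set.univ) (_ : ∀ n, diam d (E n) < ENNReal.ofReal ε),
    ∑' n, diamPow d s (E n)

/-- `dim_H(X, d, ε) = sup {s ≥ 0 : H_ε^s(X, d) ≥ 1}`, in `[0, ∞]`. -/
def dimHScale (d : X → X → ℝ) (ε : ℝ) : ℝ≥0∞ :=
  ⨆ (s : ℝ≥0) (_ : 1 ≤ hausdorffPre d ε s), (s : ℝ≥0∞)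

/-- The dynamical metric `d_n(x, y) = max {d(f^i x, f^i y) : 0 ≤ i < n}` (it is `0` for `n = 0`). -/
def dynDist (d : X → X → ℝ) (f : X → X) (n : ℕ) (x y : X) : ℝ :=
  ⨆ i : Fin n, d (f^[i] x) (f^[i] y)

/-- `liminf_{n → ∞} (1 / n) dim_H(X, d_n, ε)`. -/
def lowerMdimHAt (d : X → X → ℝ) (f : X → X) (ε : ℝ) : ℝ≥0∞ :=
  liminf (fun n : ℕ => dimHScale (dynDist d f n) ε / (n : ℝ≥0∞)) atTop

/-- The lower mean Hausdorff dimension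
`lim_{ε → 0} liminf_{n → ∞} (1 / n) dim_H(X, d_n, ε)`, in `[0, ∞]`. The inner quantity increases
as `ε` decreases, so the limit is a supremum; see `tendsto_lowerMdimHAt`. -/
def lowerMdimH (d : X → X → ℝ) (f : X → X) : ℝ≥0∞ :=
  ⨆ (ε : ℝ) (_ : 0 < ε), lowerMdimHAt d f ε

theorem dimHScale_antitone (d : X → X → ℝ) : Antitone (dimHScale d) := by
  intro ε₁ ε₂ h
  refine iSup_mono fun s => iSup_mono' fun hs => ⟨hs.trans ?_, le_rfl⟩
  refine iInf_mono fun E => iInf_mono fun _ => iInf_mono' fun hE => ⟨fun n => ?_, le_rfl⟩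
  exact (hE n).trans_le (ENNReal.ofReal_le_ofReal h)

theorem lowerMdimHAt_antitone (d : X → X → ℝ) (f : X → X) : Antitone (lowerMdimHAt d f) := by
  intro ε₁ ε₂ h
  refine liminf_le_liminf (Eventually.of_forall fun n => ?_)
  exact ENNReal.div_le_div_right (dimHScale_antitone _ h) _

/-- The supremum that defines `lowerMdimH` is the limit as `ε → 0`. -/
theorem tendsto_lowerMdimHAt (d : X → X → ℝ) (f : X → X) :
    Tendsto (lowerMdimHAt d f) (𝓝[>] 0) (𝓝 (lowerMdimH d f)) := by
  have h := (lowerMdimHAt_antitone d f).tendsto_nhdsGT 0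
  rwa [sSup_image] at h

end

end MeanHausdorff

namespace MeanHausdorff

open Filter Topology Set
open scoped ENNReal NNReal

/-! The core is a product inequality at one fixed scale (`mul_dimHScale_add_le`): if `5 * ε ^ (1 -
c) ≤ 1`, then `c` times the sum of the dimensions of the factors at scale `ε` is at most the
dimension of the product at scale `ε / 6`. The condition on `ε` involves neither the metrics nor the
exponents, so it serves all the metrics `dynDist d f n` at once; one divides by `n`, takes the
liminf, and lets `ε → 0` and `c → 1`.

For the core, weighted covers replace a Frostman measure. Given boxes `A k ×ˢ B k` of size `r k`
that cover the product, for each `x` the `B k` with `x ∈ A k` cover `Y`, so their `r k ^ t` sum to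
at least 1. Hence the `A k` with weights `r k ^ t` cover `X` with multiplicity at least 1, and
`le_sum_of_weighted_cover` gives `1 ≤ ∑ r k ^ t * (5 * r k) ^ s`. The factor `5 ^ s` is absorbed by
lowering the exponent `s + t` to `c * (s + t)`. -/

/-- A continuous pseudometric on a topological space, as a bare function. -/
structure IsContPseudoDist {X : Type*} [TopologicalSpace X] (d : X → X → ℝ) : Prop where
  self : ∀ x, d x x = 0
  comm : ∀ x y, d x y = d y x
  triangle : ∀ x y z, d x z ≤ d x y + d y z
  continuous : Continuous fun p : X × X => d p.1 p.2

variable {X Y : Type*}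

theorem IsContPseudoDist.nonneg [TopologicalSpace X] {d : X → X → ℝ} (hd : IsContPseudoDist d)
    (x y : X) : 0 ≤ d x y := by
  have h₁ := hd.triangle x y x
  have h₂ := hd.comm x y
  have h₃ := hd.self x
  linarith

/-! ### Diameters and finite covers. -/

theorem diam_le_ofReal {d : X → X → ℝ} {A : Set X} {r : ℝ}
    (h : ∀ x ∈ A, ∀ y ∈ A, d x y ≤ r) : diam d A ≤ ENNReal.ofReal r :=
  iSup₂_le fun x hx => iSup₂_le fun y hy => ENNReal.ofReal_le_ofReal (h x hx y hy)

theorem diam_empty (d : X → X → ℝ) : diam d ∅ = 0 := by simp [diam]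

theorem diamPow_empty (d : X → X → ℝ) (s : ℝ≥0) : diamPow d s ∅ = 0 := by simp [diamPow]

theorem diamPow_of_nonempty (d : X → X → ℝ) (s : ℝ≥0) {A : Set X} (hA : A.Nonempty) :
    diamPow d s A = diam d A ^ (s : ℝ) := by simp [diamPow, hA.ne_empty]

theorem diamPow_le (d : X → X → ℝ) (s : ℝ≥0) (A : Set X) : diamPow d s A ≤ diam d A ^ (s : ℝ) := by
  rcases A.eq_empty_or_nonempty with rfl | hA
  · simp [diamPow_empty]
  · rw [diamPow_of_nonempty d s hA]

theorem le_toReal_diam {d : X → X → ℝ} {A : Set X} (hA : diam d A ≠ ∞) {x y : X} (hx : x ∈ A)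
    (hy : y ∈ A) : d x y ≤ (diam d A).toReal := by
  rw [← ENNReal.ofReal_le_iff_le_toReal hA]
  exact (le_iSup₂ (f := fun y (_ : y ∈ A) => ENNReal.ofReal (d x y)) y hy).trans
    (le_iSup₂ (f := fun x (_ : x ∈ A) => ⨆ y ∈ A, ENNReal.ofReal (d x y)) x hx)

theorem hausdorffPre_le_sum {d : X → X → ℝ} {ε : ℝ} {s : ℝ≥0} (hε : 0 < ε) (F : Finset ℕ)
    (A : ℕ → Set X) (r : ℕ → ℝ) (hcov : ∀ x, ∃ k ∈ F, x ∈ A k)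
    (hr : ∀ k ∈ F, 0 < r k ∧ r k < ε) (hA : ∀ k ∈ F, ∀ x ∈ A k, ∀ y ∈ A k, d x y ≤ r k) :
    hausdorffPre d ε s ≤ ENNReal.ofReal (∑ k ∈ F, r k ^ (s : ℝ)) := by
  classical
  refine (iInf₂_le (fun k => if k ∈ F then A k else ∅) ?_).trans
    ((iInf_le _ fun k => ?_).trans ?_)
  · refine eq_univ_of_forall fun x => ?_
    obtain ⟨k, hk, hx⟩ := hcov x
    exact mem_iUnion.2 ⟨k, by simpa [hk] using hx⟩
  · by_cases hk : k ∈ F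
    · simp only [hk, if_true]
      exact (diam_le_ofReal (hA k hk)).trans_lt
        ((ENNReal.ofReal_lt_ofReal_iff hε).2 (hr k hk).2)
    · simpa [hk, diam_empty] using hε
  · rw [tsum_eq_sum (s := F) fun k hk => by simp [hk, diamPow_empty],
      ENNReal.ofReal_sum_of_nonneg fun k hk => Real.rpow_nonneg (hr k hk).1.le _]
    refine Finset.sum_le_sum fun k hk => ?_
    simp only [hk, if_true]
    rw [← ENNReal.ofReal_rpow_of_pos (hr k hk).1]
    exact (diamPow_le d s _).trans
      (ENNReal.rpow_le_rpow (diam_le_ofReal (hA k hk)) s.coe_nonneg)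

theorem one_le_sum_of_cover {d : X → X → ℝ} {ε : ℝ} {s : ℝ≥0} (hε : 0 < ε)
    (hs : 1 ≤ hausdorffPre d ε s) (F : Finset ℕ)
    (A : ℕ → Set X) (r : ℕ → ℝ) (hcov : ∀ x, ∃ k ∈ F, x ∈ A k)
    (hr : ∀ k ∈ F, 0 < r k ∧ r k < ε) (hA : ∀ k ∈ F, ∀ x ∈ A k, ∀ y ∈ A k, d x y ≤ r k) :
    1 ≤ ∑ k ∈ F, r k ^ (s : ℝ) := by
  have h := hs.trans (hausdorffPre_le_sum hε F A r hcov hr hA)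
  rwa [ENNReal.one_le_ofReal] at h

/-! ### Vitali selection and weighted covers. -/

/-- A cover with small sets contains a disjoint subfamily whose fivefold enlargement is a cover. -/
theorem exists_disjoint_subfamily_one_le_sum [TopologicalSpace X] {d : X → X → ℝ}
    (hd : IsContPseudoDist d) {ε : ℝ} {s : ℝ≥0} (hε : 0 < ε) (hs : 1 ≤ hausdorffPre d ε s)
    (F : Finset ℕ) (A : ℕ → Set X) (r : ℕ → ℝ) (hcov : ∀ x, ∃ k ∈ F, x ∈ A k)
    (hne : ∀ k ∈ F, (A k).Nonempty) (hr : ∀ k ∈ F, 0 < r k ∧ 5 * r k < ε)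
    (hA : ∀ k ∈ F, ∀ x ∈ A k, ∀ y ∈ A k, d x y ≤ r k) :
    ∃ U ⊆ F, (U : Set ℕ).PairwiseDisjoint A ∧ 1 ≤ ∑ k ∈ U, (5 * r k) ^ (s : ℝ) := by
  classical
  obtain ⟨u, huF, hdisj, hu⟩ := Vitali.exists_disjoint_subfamily_covering_enlargement A (F : Set ℕ)
    r 2 one_lt_two (fun a ha => (hr a ha).1.le) ε
    (fun a ha => by have := hr a ha; linarith) hne
  have hmem : ∀ k, k ∈ F.filter (· ∈ u) ↔ k ∈ u := fun k => by
    simpa using fun hk => huF hk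
  refine ⟨F.filter (· ∈ u), Finset.filter_subset _ _, fun a ha b hb => ?_, ?_⟩
  · exact hdisj ((hmem a).1 ha) ((hmem b).1 hb)
  -- Each `A a` meets a selected `A b` with `r a ≤ 2 * r b`, so the union of those attached to `b`
  -- has diameter at most `(2 + 1 + 2) * r b`.
  refine one_le_sum_of_cover hε hs _
    (fun b => {x | ∃ a ∈ F, x ∈ A a ∧ (A a ∩ A b).Nonempty ∧ r a ≤ 2 * r b}) _ ?_ ?_ ?_
  · intro x
    obtain ⟨a, ha, hx⟩ := hcov x
    obtain ⟨b, hb, hab, hrab⟩ := hu a ha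
    exact ⟨b, (hmem b).2 hb, a, ha, hx, hab, hrab⟩
  · intro k hk
    have := hr k (huF ((hmem k).1 hk))
    exact ⟨by linarith, this.2⟩
  · rintro b hb x ⟨a, ha, hxa, ⟨z, hza, hzb⟩, hrab⟩ y ⟨a', ha', hya, ⟨z', hza', hzb'⟩, hrab'⟩
    have h₁ := hd.triangle x z y
    have h₂ := hd.triangle z z' y
    have h₃ := hA a ha x hxa z hza
    have h₄ := hA b (huF ((hmem b).1 hb)) z hzb z' hzb'
    have h₅ := hA a' ha' z' hza' y hya
    linarith

open Classical in
/-- A weighted cover of total multiplicity at least `T` has weighted Hausdorff sum at least `T`. -/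
theorem le_sum_of_weighted_cover [TopologicalSpace X] [Nonempty X] {d : X → X → ℝ}
    (hd : IsContPseudoDist d) {ε : ℝ} {s : ℝ≥0} (hε : 0 < ε) (hs : 1 ≤ hausdorffPre d ε s)
    (F : Finset ℕ) (A : ℕ → Set X) (r : ℕ → ℝ)
    (hne : ∀ k ∈ F, (A k).Nonempty) (hr : ∀ k ∈ F, 0 < r k ∧ 5 * r k < ε)
    (hA : ∀ k ∈ F, ∀ x ∈ A k, ∀ y ∈ A k, d x y ≤ r k) (w : ℕ → ℝ) (hw : ∀ k ∈ F, 0 ≤ w k)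
    {T : ℝ} (hT : 0 ≤ T) (hTw : ∀ x, T ≤ ∑ k ∈ F with x ∈ A k, w k) :
    T ≤ ∑ k ∈ F, w k * (5 * r k) ^ (s : ℝ) := by
  have hpow : ∀ k ∈ F, 0 ≤ (5 * r k) ^ (s : ℝ) := fun k hk =>
    Real.rpow_nonneg (by linarith [(hr k hk).1]) _
  -- Induction on the number of indices of positive weight.
  induction hn : (F.filter (0 < w ·)).card using Nat.strong_induction_on generalizing w T with
  | _ n ih =>
  rcases hT.eq_or_lt with rfl | hT0
  · exact Finset.sum_nonneg fun k hk => mul_nonneg (hw k hk) (hpow k hk)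
  have hcov : ∀ x, ∃ k ∈ F.filter (0 < w ·), x ∈ A k := by
    intro x
    by_contra! h
    have : ∑ k ∈ F with x ∈ A k, w k ≤ 0 := Finset.sum_nonpos fun k hk => by
      rw [Finset.mem_filter] at hk
      by_contra! hk0
      exact h k (Finset.mem_filter.2 ⟨hk.1, hk0⟩) hk.2
    linarith [hTw x]
  have hsub : ∀ k ∈ F.filter (0 < w ·), k ∈ F := fun k hk => (Finset.mem_filter.1 hk).1
  obtain ⟨U, hU, hdisj, hsum⟩ := exists_disjoint_subfamily_one_le_sum hd hε hs _ A r hcov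
    (fun k hk => hne k (hsub k hk)) (fun k hk => hr k (hsub k hk)) (fun k hk => hA k (hsub k hk))
  have hUF : U ⊆ F := fun k hk => hsub k (hU hk)
  have hUne : U.Nonempty := by
    rw [Finset.nonempty_iff_ne_empty]
    rintro rfl
    norm_num at hsum
  obtain ⟨m, hmU, hm⟩ := U.exists_min_image w hUne
  -- Removing `θ` from the weights on the disjoint family `U` costs each point at most `θ` of
  -- multiplicity, while the weighted sum drops by at least `θ`. Either `θ = T` and nothing remains
  -- to prove, or `θ = w m` and `m` leaves the support.
  set θ := min T (w m) with hθ
  have hθ0 : 0 ≤ θ := le_min hT (hw m (hUF hmU))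
  have hθT : θ ≤ T := min_le_left _ _
  set v : ℕ → ℝ := fun k => w k - if k ∈ U then θ else 0 with hv
  have hvw : ∀ k, v k ≤ w k := fun k => by
    simp only [hv]; split_ifs <;> linarith
  have hv0 : ∀ k ∈ F, 0 ≤ v k := fun k hk => by
    simp only [hv]
    split_ifs with h
    · linarith [hm k h, min_le_right T (w m)]
    · linarith [hw k hk]
  have hTv : ∀ x, T - θ ≤ ∑ k ∈ F with x ∈ A k, v k := by
    intro x
    have hcard : ((F.filter (x ∈ A ·)).filter (· ∈ U)).card ≤ 1 := by
      refine Finset.card_le_one.2 fun a ha b hb => ?_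
      simp only [Finset.mem_filter] at ha hb
      by_contra hab
      exact Set.disjoint_left.1 (hdisj ha.2 hb.2 hab) ha.1.2 hb.1.2
    have hle : ∑ k ∈ F with x ∈ A k, (if k ∈ U then θ else 0) ≤ θ := by
      rw [← Finset.sum_filter, Finset.sum_const, nsmul_eq_mul]
      have : ((((F.filter (x ∈ A ·)).filter (· ∈ U)).card : ℕ) : ℝ) ≤ 1 := by exact_mod_cast hcard
      nlinarith
    simp only [hv, Finset.sum_sub_distrib]
    linarith [hTw x]
  have hsplit : ∑ k ∈ F, w k * (5 * r k) ^ (s : ℝ) =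
      ∑ k ∈ F, v k * (5 * r k) ^ (s : ℝ) + θ * ∑ k ∈ U, (5 * r k) ^ (s : ℝ) := by
    have : ∑ k ∈ U, (5 * r k) ^ (s : ℝ) = ∑ k ∈ F, if k ∈ U then (5 * r k) ^ (s : ℝ) else 0 := by
      rw [← Finset.sum_filter, Finset.filter_mem_eq_inter, Finset.inter_eq_right.2 hUF]
    rw [this, Finset.mul_sum, ← Finset.sum_add_distrib]
    refine Finset.sum_congr rfl fun k _ => ?_
    simp only [hv]
    split_ifs <;> ring
  have hrest : T - θ ≤ ∑ k ∈ F, v k * (5 * r k) ^ (s : ℝ) := by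
    rcases le_total T (w m) with h | h
    · rw [hθ, min_eq_left h, sub_self]
      exact Finset.sum_nonneg fun k hk => mul_nonneg (hv0 k hk) (hpow k hk)
    · refine ih _ ?_ v hv0 (sub_nonneg.2 hθT) hTv rfl
      rw [← hn]
      refine Finset.card_lt_card ((Finset.ssubset_iff_of_subset fun k hk => ?_).2 ⟨m, hU hmU, ?_⟩)
      · rw [Finset.mem_filter] at hk ⊢
        exact ⟨hk.1, hk.2.trans_le (hvw k)⟩
      · simp [hv, hmU, hθ, min_eq_right h]
  have := le_mul_of_one_le_right hθ0 hsum
  linarith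

/-! ### The product inequality at a fixed scale. -/

/-- The max metric on a product. -/
abbrev prodDist (dX : X → X → ℝ) (dY : Y → Y → ℝ) (p q : X × Y) : ℝ :=
  max (dX p.1 q.1) (dY p.2 q.2)

/-- A finite cover of a product by small boxes satisfies a lower bound on its Hausdorff sum. -/
theorem one_le_sum_of_box_cover [TopologicalSpace X] [Nonempty X] {dX : X → X → ℝ}
    (hX : IsContPseudoDist dX) {dY : Y → Y → ℝ} {ε : ℝ} {s t : ℝ≥0} (hε : 0 < ε)
    (hs : 1 ≤ hausdorffPre dX ε s) (ht : 1 ≤ hausdorffPre dY ε t)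
    (F : Finset ℕ) (A : ℕ → Set X) (B : ℕ → Set Y) (r : ℕ → ℝ)
    (hcov : ∀ x y, ∃ k ∈ F, x ∈ A k ∧ y ∈ B k)
    (hne : ∀ k ∈ F, (A k).Nonempty) (hr : ∀ k ∈ F, 0 < r k ∧ 5 * r k < ε)
    (hA : ∀ k ∈ F, ∀ x ∈ A k, ∀ y ∈ A k, dX x y ≤ r k)
    (hB : ∀ k ∈ F, ∀ x ∈ B k, ∀ y ∈ B k, dY x y ≤ r k) :
    1 ≤ ∑ k ∈ F, r k ^ (t : ℝ) * (5 * r k) ^ (s : ℝ) := by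
  classical
  refine le_sum_of_weighted_cover hX hε hs F A r hne hr hA (fun k => r k ^ (t : ℝ))
    (fun k hk => Real.rpow_nonneg (hr k hk).1.le _) zero_le_one fun x => ?_
  have hsub : ∀ k ∈ F.filter (x ∈ A ·), k ∈ F := fun k hk => (Finset.mem_filter.1 hk).1
  refine one_le_sum_of_cover hε ht _ B r (fun y => ?_) (fun k hk => ?_)
    fun k hk => hB k (hsub k hk)
  · obtain ⟨k, hk, hx, hy⟩ := hcov x y
    exact ⟨k, Finset.mem_filter.2 ⟨hk, hx⟩, hy⟩
  · have := hr k (hsub k hk)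
    exact ⟨this.1, by linarith⟩

/-- The spare power `r ^ ((1 - c) * (s + t))` pays for `5 ^ s`, because `5 * r ^ (1 - c) ≤ 1`; this
is uniform in `s` and `t`. -/
theorem rpow_mul_rpow_le {r ε : ℝ} {c s t : ℝ≥0} (hr : 0 < r) (hrε : r ≤ ε) (hc : c < 1)
    (hεc : 5 * ε ^ (1 - c : ℝ) ≤ 1) :
    r ^ (t : ℝ) * (5 * r) ^ (s : ℝ) ≤ r ^ ((c * (s + t) : ℝ≥0) : ℝ) := by
  have hc' : (0 : ℝ) ≤ 1 - c := sub_nonneg.2 (by exact_mod_cast hc.le)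
  have h0 : 0 ≤ r ^ (1 - c : ℝ) := Real.rpow_nonneg hr.le _
  have h1 : r ^ (1 - c : ℝ) ≤ ε ^ (1 - c : ℝ) := Real.rpow_le_rpow hr.le hrε hc'
  have h2 : (5 * r ^ (1 - c : ℝ)) ^ (s : ℝ) ≤ 1 :=
    Real.rpow_le_one (by positivity) (by linarith) s.coe_nonneg
  have h3 : (r ^ (1 - c : ℝ)) ^ (t : ℝ) ≤ 1 :=
    Real.rpow_le_one h0 (by linarith) t.coe_nonneg
  have key : r ^ (t : ℝ) * (5 * r) ^ (s : ℝ) = r ^ ((c * (s + t) : ℝ≥0) : ℝ) *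
      ((5 * r ^ (1 - c : ℝ)) ^ (s : ℝ) * (r ^ (1 - c : ℝ)) ^ (t : ℝ)) := by
    rw [Real.mul_rpow (by norm_num) hr.le, Real.mul_rpow (by norm_num) h0, ← Real.rpow_mul hr.le,
      ← Real.rpow_mul hr.le]
    have : r ^ (t : ℝ) * r ^ (s : ℝ) = r ^ ((c * (s + t) : ℝ≥0) : ℝ) *
        (r ^ ((1 - c) * s : ℝ) * r ^ ((1 - c) * t : ℝ)) := by
      rw [← Real.rpow_add hr, ← Real.rpow_add hr, ← Real.rpow_add hr]
      push_cast
      congr 1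
      ring
    linear_combination (5 : ℝ) ^ (s : ℝ) * this
  rw [key]
  exact mul_le_of_le_one_right (Real.rpow_nonneg hr.le _)
    (mul_le_one₀ h2 (Real.rpow_nonneg h0 _) h3)

theorem IsContPseudoDist.isOpen_thickening [TopologicalSpace X] {d : X → X → ℝ}
    (hd : IsContPseudoDist d) (A : Set X) (η : ℝ) : IsOpen {x | ∃ a ∈ A, d x a < η} := by
  have : {x | ∃ a ∈ A, d x a < η} = ⋃ a ∈ A, {x | d x a < η} := by ext; simp
  rw [this]
  exact isOpen_biUnion fun a _ =>
    isOpen_lt (hd.continuous.comp (continuous_id.prodMk continuous_const)) continuous_const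

/-- The sets of a cover admit upper bounds for the diameters with almost the same powers. -/
theorem exists_radius (d : X → X → ℝ) {ε : ℝ} (s : ℝ≥0) {A : Set X} (hA : A.Nonempty)
    (hAε : diam d A < ENNReal.ofReal ε) {η : ℝ≥0} (hη : 0 < η) :
    ∃ r : ℝ, (diam d A).toReal < r ∧ r < ε ∧ ENNReal.ofReal (r ^ (s : ℝ)) ≤ diamPow d s A + η := by
  have htop : diam d A ≠ ∞ := hAε.ne_top
  set D := (diam d A).toReal with hD
  have hDε : D < ε := (ENNReal.lt_ofReal_iff_toReal_lt htop).1 hAε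
  have hcont : Tendsto (fun r : ℝ => r ^ (s : ℝ)) (𝓝[>] D) (𝓝 (D ^ (s : ℝ))) :=
    (Real.continuousAt_rpow_const D s (Or.inr s.coe_nonneg)).mono_left nhdsWithin_le_nhds
  have hev : ∀ᶠ r in 𝓝[>] D, r ^ (s : ℝ) < D ^ (s : ℝ) + η :=
    hcont.eventually (gt_mem_nhds (lt_add_of_pos_right _ (by exact_mod_cast hη)))
  obtain ⟨r, hr, hrD⟩ := (hev.and (Ioo_mem_nhdsGT hDε)).exists
  refine ⟨r, hrD.1, hrD.2, ?_⟩
  rw [diamPow_of_nonempty d s hA, ← ENNReal.ofReal_toReal htop, ← hD,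
    ENNReal.ofReal_rpow_of_nonneg ENNReal.toReal_nonneg s.coe_nonneg, ← ENNReal.ofReal_coe_nnreal,
    ← ENNReal.ofReal_add (Real.rpow_nonneg ENNReal.toReal_nonneg _) η.coe_nonneg]
  exact ENNReal.ofReal_le_ofReal hr.le

/-- Product inequality for the Hausdorff content at a fixed small scale. -/
theorem one_le_hausdorffPre_prod [TopologicalSpace X] [CompactSpace X] [Nonempty X]
    [TopologicalSpace Y] [CompactSpace Y] {dX : X → X → ℝ} (hX : IsContPseudoDist dX)
    {dY : Y → Y → ℝ} (hY : IsContPseudoDist dY) {ε : ℝ} {c s t : ℝ≥0} (hε : 0 < ε) (hc : c < 1)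
    (hεc : 5 * ε ^ (1 - c : ℝ) ≤ 1)
    (hs : 1 ≤ hausdorffPre dX ε s) (ht : 1 ≤ hausdorffPre dY ε t) :
    1 ≤ hausdorffPre (prodDist dX dY) (ε / 6) (c * (s + t)) := by
  classical
  refine le_iInf fun E => le_iInf fun hE => le_iInf fun hEε => ?_
  refine ENNReal.le_of_forall_pos_le_add fun η hη _ => ?_
  obtain ⟨η', hη'0, hη'⟩ := ENNReal.exists_pos_sum_of_countable
    (ENNReal.coe_ne_zero.2 hη.ne') ℕ
  have hrad : ∀ k, ∃ r : ℝ, (E k).Nonempty → (diam (prodDist dX dY) (E k)).toReal < r ∧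
      r < ε / 6 ∧ ENNReal.ofReal (r ^ ((c * (s + t) : ℝ≥0) : ℝ)) ≤
        diamPow (prodDist dX dY) (c * (s + t)) (E k) + η' k := by
    intro k
    by_cases hk : (E k).Nonempty
    · obtain ⟨r, hr⟩ := exists_radius (prodDist dX dY) (c * (s + t)) hk (hEε k) (hη'0 k)
      exact ⟨r, fun _ => hr⟩
    · exact ⟨0, fun h => (hk h).elim⟩
  choose r hr using hrad
  set D : ℕ → ℝ := fun k => (diam (prodDist dX dY) (E k)).toReal with hD
  have hD0 : ∀ k, 0 ≤ D k := fun k => ENNReal.toReal_nonneg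
  have hdist : ∀ k, ∀ p ∈ E k, ∀ q ∈ E k, dX p.1 q.1 ≤ D k ∧ dY p.2 q.2 ≤ D k :=
    fun k p hp q hq => max_le_iff.1 (le_toReal_diam (hEε k).ne_top hp hq)
  -- Thickening by half of the gap makes the sets open, so that compactness yields a finite
  -- subcover, and keeps the diameters at most `D k + 2 * ((r k - D k) / 2) = r k`.
  set A : ℕ → Set X := fun k => {x | ∃ a ∈ Prod.fst '' E k, dX x a < (r k - D k) / 2} with hAdef
  set B : ℕ → Set Y := fun k => {y | ∃ b ∈ Prod.snd '' E k, dY y b < (r k - D k) / 2} with hBdef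
  have hsubset : ∀ k, E k ⊆ A k ×ˢ B k := by
    intro k p hp
    have := (hr k ⟨p, hp⟩).1
    refine ⟨⟨p.1, ⟨p, hp, rfl⟩, ?_⟩, ⟨p.2, ⟨p, hp, rfl⟩, ?_⟩⟩
    · rw [hX.self]; linarith
    · rw [hY.self]; linarith
  obtain ⟨G, hG⟩ := isCompact_univ.elim_finite_subcover (fun k => A k ×ˢ B k)
    (fun k => (hX.isOpen_thickening _ _).prod (hY.isOpen_thickening _ _))
    (by rw [← hE]; exact iUnion_mono hsubset)
  have hAne : ∀ k, (A k).Nonempty → (E k).Nonempty := by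
    rintro k ⟨x, a, ⟨p, hp, -⟩, -⟩
    exact ⟨p, hp⟩
  have hF : ∀ k ∈ G.filter (fun k => (E k).Nonempty), (E k).Nonempty := fun k hk =>
    (Finset.mem_filter.1 hk).2
  -- The scale `ε / 6` leaves room for the fivefold enlargement.
  have hr' : ∀ k, (E k).Nonempty → 0 < r k ∧ 5 * r k < ε := fun k hk => by
    have := hr k hk
    have := hD0 k
    constructor <;> linarith
  have hsum := one_le_sum_of_box_cover hX hε hs ht (G.filter fun k => (E k).Nonempty) A B r
    (fun x y => by
      obtain ⟨k, hk, hxy⟩ := mem_iUnion₂.1 (hG (mem_univ (x, y)))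
      exact ⟨k, Finset.mem_filter.2 ⟨hk, hAne k ⟨x, hxy.1⟩⟩, hxy⟩)
    (fun k hk => by
      obtain ⟨p, hp⟩ := hF k hk
      exact ⟨p.1, (hsubset k hp).1⟩)
    (fun k hk => hr' k (hF k hk))
    (by
      rintro k - x ⟨_, ⟨p, hp, rfl⟩, hxp⟩ y ⟨_, ⟨q, hq, rfl⟩, hyq⟩
      have h₁ := hX.triangle x p.1 y
      have h₂ := hX.triangle p.1 q.1 y
      rw [hX.comm] at hyq
      linarith [(hdist k p hp q hq).1])
    (by
      rintro k - x ⟨_, ⟨p, hp, rfl⟩, hxp⟩ y ⟨_, ⟨q, hq, rfl⟩, hyq⟩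
      have h₁ := hY.triangle x p.2 y
      have h₂ := hY.triangle p.2 q.2 y
      rw [hY.comm] at hyq
      linarith [(hdist k p hp q hq).2])
  have hsum' := hsum.trans (Finset.sum_le_sum fun k hk =>
    rpow_mul_rpow_le (hr' k (hF k hk)).1 (by have := hr' k (hF k hk); linarith) hc hεc)
  rw [← ENNReal.one_le_ofReal, ENNReal.ofReal_sum_of_nonneg fun k hk =>
    Real.rpow_nonneg (hr' k (hF k hk)).1.le _] at hsum'
  calc (1 : ℝ≥0∞) ≤ _ := hsum'
    _ ≤ ∑ k ∈ G with (E k).Nonempty,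
        (diamPow (prodDist dX dY) (c * (s + t)) (E k) + η' k) :=
      Finset.sum_le_sum fun k hk => (hr k (hF k hk)).2.2
    _ ≤ ∑' k, (diamPow (prodDist dX dY) (c * (s + t)) (E k) + η' k) := ENNReal.sum_le_tsum _
    _ = ∑' k, diamPow (prodDist dX dY) (c * (s + t)) (E k) + ∑' k, (η' k : ℝ≥0∞) :=
      ENNReal.tsum_add
    _ ≤ _ := add_le_add le_rfl hη'.le

/-- Rests on the convention `0 ^ 0 = 1`. It makes the sets of admissible exponents nonempty, as is
needed to move sums inside the suprema. -/
theorem one_le_hausdorffPre_zero [Nonempty X] (d : X → X → ℝ) (ε : ℝ) :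
    1 ≤ hausdorffPre d ε 0 := by
  refine le_iInf fun E => le_iInf fun hE => le_iInf fun _ => ?_
  obtain ⟨k, hk⟩ := mem_iUnion.1 (hE ▸ mem_univ (Classical.arbitrary X))
  refine le_trans ?_ (ENNReal.le_tsum k)
  simp [diamPow_of_nonempty d 0 ⟨_, hk⟩]

theorem mul_dimHScale_add_le [TopologicalSpace X] [CompactSpace X] [Nonempty X]
    [TopologicalSpace Y] [CompactSpace Y] [Nonempty Y] {dX : X → X → ℝ}
    (hX : IsContPseudoDist dX) {dY : Y → Y → ℝ} (hY : IsContPseudoDist dY) {ε : ℝ} {c : ℝ≥0}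
    (hε : 0 < ε) (hc : c < 1) (hεc : 5 * ε ^ (1 - c : ℝ) ≤ 1) :
    c * (dimHScale dX ε + dimHScale dY ε) ≤ dimHScale (prodDist dX dY) (ε / 6) := by
  unfold dimHScale
  rw [iSup_subtype', iSup_subtype']
  have : Nonempty {s : ℝ≥0 // 1 ≤ hausdorffPre dX ε s} := ⟨0, one_le_hausdorffPre_zero _ _⟩
  have : Nonempty {s : ℝ≥0 // 1 ≤ hausdorffPre dY ε s} := ⟨0, one_le_hausdorffPre_zero _ _⟩
  rw [ENNReal.iSup_add, ENNReal.mul_iSup]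
  refine iSup_le fun s => ?_
  rw [ENNReal.add_iSup, ENNReal.mul_iSup]
  refine iSup_le fun t => ?_
  have := one_le_hausdorffPre_prod hX hY hε hc hεc s.2 t.2
  refine le_trans ?_ (le_iSup₂ (c * (s.1 + t.1)) this)
  push_cast
  exact le_rfl

/-! ### Dynamical metrics and passage to the limit. -/

theorem isContPseudoDist_dist [PseudoMetricSpace X] :
    IsContPseudoDist fun x y : X => dist x y :=
  ⟨dist_self, dist_comm, dist_triangle, continuous_dist⟩

/-- The empty real supremum is `0`, so at `n = 0` only a pseudometric remains; `IsContPseudoDist`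
covers this case. -/
theorem dynDist_zero (d : X → X → ℝ) (f : X → X) (x y : X) : dynDist d f 0 x y = 0 := by
  simp [dynDist]

theorem le_dynDist (d : X → X → ℝ) (f : X → X) {n : ℕ} (i : Fin n) (x y : X) :
    d (f^[i] x) (f^[i] y) ≤ dynDist d f n x y :=
  le_ciSup (f := fun i : Fin n => d (f^[i] x) (f^[i] y)) (Set.finite_range _).bddAbove i

theorem IsContPseudoDist.dynDist [TopologicalSpace X] {d : X → X → ℝ} (hd : IsContPseudoDist d)
    {f : X → X} (hf : Continuous f) (n : ℕ) : IsContPseudoDist (dynDist d f n) where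
  self x := by simp [MeanHausdorff.dynDist, hd.self]
  comm x y := by simp [MeanHausdorff.dynDist, hd.comm]
  triangle x y z := by
    rcases n.eq_zero_or_pos with rfl | hn
    · simp [dynDist_zero]
    have : Nonempty (Fin n) := ⟨⟨0, hn⟩⟩
    exact ciSup_le fun i => (hd.triangle _ (f^[i] y) _).trans
      (add_le_add (le_dynDist d f i x y) (le_dynDist d f i y z))
  continuous := by
    rcases n.eq_zero_or_pos with rfl | hn
    · simpa [dynDist_zero] using continuous_const
    have : Nonempty (Fin n) := ⟨⟨0, hn⟩⟩
    have : (fun p : X × X => MeanHausdorff.dynDist d f n p.1 p.2) = fun p =>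
        Finset.univ.sup' Finset.univ_nonempty fun i : Fin n => d (f^[i] p.1) (f^[i] p.2) := by
      funext p
      rw [Finset.sup'_univ_eq_ciSup]
      rfl
    rw [this]
    refine Continuous.finset_sup'_apply _ fun i _ => ?_
    exact hd.continuous.comp (((hf.iterate i).comp continuous_fst).prodMk
      ((hf.iterate i).comp continuous_snd))

theorem dynDist_prodDist (dX : X → X → ℝ) (dY : Y → Y → ℝ) (f : X → X) (g : Y → Y) (n : ℕ) :
    dynDist (prodDist dX dY) (Prod.map f g) n = prodDist (dynDist dX f n) (dynDist dY g n) := by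
  funext p q
  rcases n.eq_zero_or_pos with rfl | hn
  · simp [dynDist_zero]
  have : Nonempty (Fin n) := ⟨⟨0, hn⟩⟩
  have h : ∀ u v : Fin n → ℝ, ⨆ i, max (u i) (v i) = max (⨆ i, u i) (⨆ i, v i) := fun u v => by
    refine le_antisymm (ciSup_le fun i => max_le_max ?_ ?_)
      (max_le (ciSup_le fun i => ?_) (ciSup_le fun i => ?_))
    · exact le_ciSup (Set.finite_range u).bddAbove i
    · exact le_ciSup (Set.finite_range v).bddAbove i
    · exact (le_max_left _ _).trans
        (le_ciSup (f := fun i => max (u i) (v i)) (Set.finite_range _).bddAbove i)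
    · exact (le_max_right _ _).trans
        (le_ciSup (f := fun i => max (u i) (v i)) (Set.finite_range _).bddAbove i)
  simpa only [dynDist, prodDist, Prod.map_iterate, Prod.map_fst, Prod.map_snd] using h _ _

theorem liminf_add_liminf_le (u v : ℕ → ℝ≥0∞) :
    liminf u atTop + liminf v atTop ≤ liminf (fun n => u n + v n) atTop := by
  simp only [liminf_eq_iSup_iInf_of_nat]
  refine ENNReal.iSup_add_iSup_le fun i j => ?_
  refine le_trans ?_ (le_iSup _ (max i j))
  exact le_iInf₂ fun n hn => add_le_add (iInf₂_le n ((le_max_left i j).trans hn))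
    (iInf₂_le n ((le_max_right i j).trans hn))

theorem mul_lowerMdimHAt_add_le [TopologicalSpace X] [CompactSpace X] [Nonempty X]
    [TopologicalSpace Y] [CompactSpace Y] [Nonempty Y] {dX : X → X → ℝ}
    (hX : IsContPseudoDist dX) {dY : Y → Y → ℝ} (hY : IsContPseudoDist dY)
    {f : X → X} (hf : Continuous f) {g : Y → Y} (hg : Continuous g) {ε : ℝ} {c : ℝ≥0}
    (hε : 0 < ε) (hc : c < 1) (hεc : 5 * ε ^ (1 - c : ℝ) ≤ 1) :
    c * (lowerMdimHAt dX f ε + lowerMdimHAt dY g ε) ≤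
      lowerMdimHAt (prodDist dX dY) (Prod.map f g) (ε / 6) := by
  unfold lowerMdimHAt
  refine (mul_le_mul_right (liminf_add_liminf_le _ _) _).trans ?_
  rw [← ENNReal.liminf_const_mul_of_ne_top ENNReal.coe_ne_top]
  refine liminf_le_liminf (Eventually.of_forall fun n => ?_)
  rw [ENNReal.div_add_div_same, ← mul_div_assoc, dynDist_prodDist]
  exact ENNReal.div_le_div_right
    (mul_dimHScale_add_le (hX.dynDist hf n) (hY.dynDist hg n) hε hc hεc) _

/-- The threshold `(1 / 5) ^ (1 - c)⁻¹` solves `5 * ε ^ (1 - c) = 1`. -/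
theorem exists_scale {c : ℝ≥0} (hc : c < 1) {δ : ℝ} (hδ : 0 < δ) :
    ∃ ε, 0 < ε ∧ ε ≤ δ ∧ 5 * ε ^ (1 - c : ℝ) ≤ 1 := by
  have hc' : (0 : ℝ) < 1 - c := sub_pos.2 (by exact_mod_cast hc)
  refine ⟨min δ ((1 / 5 : ℝ) ^ (1 - c : ℝ)⁻¹), lt_min hδ (by positivity), min_le_left _ _, ?_⟩
  have := Real.rpow_le_rpow (le_min hδ.le (by positivity))
    (min_le_right δ ((1 / 5 : ℝ) ^ (1 - c : ℝ)⁻¹)) hc'.le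
  rw [Real.rpow_inv_rpow (by norm_num) hc'.ne'] at this
  linarith

/-- The product inequality for the lower mean Hausdorff dimension. -/
theorem lowerMdimH_add_le [TopologicalSpace X] [CompactSpace X] [Nonempty X]
    [TopologicalSpace Y] [CompactSpace Y] [Nonempty Y] {dX : X → X → ℝ}
    (hX : IsContPseudoDist dX) {dY : Y → Y → ℝ} (hY : IsContPseudoDist dY)
    {f : X → X} (hf : Continuous f) {g : Y → Y} (hg : Continuous g) :
    lowerMdimH dX f + lowerMdimH dY g ≤ lowerMdimH (prodDist dX dY) (Prod.map f g) := by
  refine ENNReal.le_of_forall_lt_one_mul_le fun c hc => ?_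
  lift c to ℝ≥0 using hc.ne_top
  replace hc : c < 1 := by exact_mod_cast hc
  conv_lhs => unfold lowerMdimH
  rw [iSup_subtype', iSup_subtype']
  have : Nonempty {ε : ℝ // 0 < ε} := ⟨1, one_pos⟩
  rw [ENNReal.iSup_add, ENNReal.mul_iSup]
  refine iSup_le fun δ₁ => ?_
  rw [ENNReal.add_iSup, ENNReal.mul_iSup]
  refine iSup_le fun δ₂ => ?_
  -- By antitonicity both scales may be replaced by a common smaller one.
  obtain ⟨ε, hε, hεδ, hεc⟩ := exists_scale hc (lt_min δ₁.2 δ₂.2)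
  calc (c : ℝ≥0∞) * (lowerMdimHAt dX f δ₁ + lowerMdimHAt dY g δ₂)
      ≤ c * (lowerMdimHAt dX f ε + lowerMdimHAt dY g ε) :=
        mul_le_mul_right (add_le_add (lowerMdimHAt_antitone dX f (hεδ.trans (min_le_left _ _)))
          (lowerMdimHAt_antitone dY g (hεδ.trans (min_le_right _ _)))) _
    _ ≤ lowerMdimHAt (prodDist dX dY) (Prod.map f g) (ε / 6) :=
        mul_lowerMdimHAt_add_le hX hY hf hg hε hc hεc
    _ ≤ _ := le_iSup₂ (f := fun ε (_ : 0 < ε) =>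
        lowerMdimHAt (prodDist dX dY) (Prod.map f g) ε) (ε / 6) (by positivity)

end MeanHausdorff

/-- The lower mean Hausdorff dimension of a product system, with respect to the max metric, is at
least the sum of the lower mean Hausdorff dimensions of the factors. -/
theorem mainTheorem4 {M : Type*} {E : Type*} [MetricSpace M] [CompactSpace M] [Nonempty M]
    [MetricSpace E] [CompactSpace E] [Nonempty E]
    (f : M → M) (hf : Continuous f) (g : E → E) (hg : Continuous g) :
    MeanHausdorff.lowerMdimH (fun x y : M => dist x y) f +
        MeanHausdorff.lowerMdimH (fun x y : E => dist x y) g ≤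
      MeanHausdorff.lowerMdimH
        (fun p q : M × E => max (dist p.1 q.1) (dist p.2 q.2)) (Prod.map f g) := by
  exact MeanHausdorff.lowerMdimH_add_le MeanHausdorff.isContPseudoDist_dist
    MeanHausdorff.isContPseudoDist_dist hf hg
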